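/- Let $X$ be a real Banach space with $\dim X\ge 2$, with unit sphere $S_X$ and dual $X^*$. For $\varepsilon\in[0,2]$ and $\tau\ge 0$ let $$\delta_X(\varepsilon)=\inf\{1-\|y+\tilde y\|/2 : y,\tilde y\in S_X,\ \|y-\tilde y\|=\varepsilon\},\qquad \rho_X(\tau)=\sup\{(\|x+\tau y\|+\|x-\tau y\|)/2-1 : x,y\in S_X\}$$ be the moduli of convexity and of smoothness of $X$. The space $X$ is called $r$-convex if there is $K>0$ with $\delta_X(\varepsilon)\ge K\varepsilon^r$ for all $\varepsilon\in[0,2]$, and $s$-smooth if there is $K>0$ with $\rho_X(\tau)\le K\tau^s$ for all $\tau>0$. Let $p>1$, $F(x)=\frac1p\|x\|^p$, and let $J_p(x)=\{x^*\in X^* : \langle x^*,x\rangle=\|x^*\|\|x\|,\ \|x^*\|=\|x\|^{p-1}\}$ be the duality mapping. For $x^*\in J_p(x)$ let $D^{x^*}(y,x)=F(y)-F(x)-\langle x^*,y-x\rangle$ be the Bregman divergence of $F$. Then the following hold. 1. There are constants $C_1,C_2>0$ such that for all $x,y\in X$ and all $x^*\in J_p(x)$ $$D^{x^*}(y,x)\le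 C_1\max\{\|x\|,\|y\|\}^p\,\rho_X\!\left(\frac{2\|x-y\|}{\max\{\|x\|,\|y\|\}}\right),\qquad D^{x^*}(y,x)\ge C_2\max\{\|x\|,\|y\|\}^p\,\delta_X\!\left(\frac{\|x-y\|}{3\max\{\|x\|,\|y\|\}}\right),$$ where the right-hand sides are read as $0$ if $x=y=0$. 2. Let $X$ be $s$-smooth. If $p=s$, there is $C>0$ such that $D^{x^*}(y,x)\le C\|x-y\|^s$ for all $x,y\in X$ and $x^*\in J_p(x)$. If $p\ne s$, then for every $\bar\tau>0$ there is $C_{\bar\tau}>0$ such that $D^{x^*}(y,x)\le C_{\bar\tau}\|x\|^{p-s}\|x-y\|^s$ for all $x,y\in X$ with $x\ne0$ and $\|x-y\|/\|x\|\le\bar\tau$, and all $x^*\in J_p(x)$. 3. Let $X$ be $r$-convex. If $p=r$, there is $\tilde C>0$ such that $D^{x^*}(y,x)\ge \tilde C\|x-y\|^r$ for all $x,y\in X$ and $x^*\in J_p(x)$. If $p\ne r$, then for every $\bar\tau>0$ there is $\tilde C_{\bar\tau}>0$ such that $D^{x^*}(y,x)\ge \tilde C_{\bar\tau}\|x\|^{p-r}\|x-y\|^r$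 for all $x,y\in X$ with $x\ne0$ and $\|x-y\|/\|x\|\le\bar\tau$, and all $x^*\in J_p(x)$. -/

import Mathlib

noncomputable section

namespace BregmanBounds

/-- The modulus of convexity `δ_X` of a normed space, used on `[0, 2]`:
`δ_X(ε) = inf {1 - ‖y + z‖ / 2 : ‖y‖ = ‖z‖ = 1, ‖y - z‖ = ε}`. -/
def modulusConvexity (X : Type*) [NormedAddCommGroup X] (ε : ℝ) : ℝ :=
  sInf {t : ℝ | ∃ y z : X, ‖y‖ = 1 ∧ ‖z‖ = 1 ∧ ‖y - z‖ = ε ∧ t = 1 - ‖y + z‖ / 2}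

/-- The modulus of smoothness `ρ_X` of a normed space, used on `[0, ∞)`:
`ρ_X(τ) = sup {(‖x + τ y‖ + ‖x - τ y‖) / 2 - 1 : ‖x‖ = ‖y‖ = 1}`. -/
def modulusSmoothness (X : Type*) [NormedAddCommGroup X] [NormedSpace ℝ X] (τ : ℝ) : ℝ :=
  sSup {t : ℝ | ∃ x y : X, ‖x‖ = 1 ∧ ‖y‖ = 1 ∧ t = (‖x + τ • y‖ + ‖x - τ • y‖) / 2 - 1}

/-- `X` is `r`-convex (convex of power type `r`). -/
def IsPowerConvex (X : Type*) [NormedAddCommGroup X] (r : ℝ) : Prop :=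
  ∃ K : ℝ, 0 < K ∧ ∀ ε ∈ Set.Icc (0 : ℝ) 2, K * ε ^ r ≤ modulusConvexity X ε

/-- `X` is `s`-smooth (smooth of power type `s`). -/
def IsPowerSmooth (X : Type*) [NormedAddCommGroup X] [NormedSpace ℝ X] (s : ℝ) : Prop :=
  ∃ K : ℝ, 0 < K ∧ ∀ τ : ℝ, 0 < τ → modulusSmoothness X τ ≤ K * τ ^ s

variable {X : Type*} [NormedAddCommGroup X] [NormedSpace ℝ X]

/-- The (set-valued) duality mapping `J_p : X → 2^{X*}`. -/
def dualityMap (p : ℝ) (x : X) : Set (X →L[ℝ] ℝ) :=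
  {ξ | ξ x = ‖ξ‖ * ‖x‖ ∧ ‖ξ‖ = ‖x‖ ^ (p - 1)}

/-- The functional `F(x) = (1/p) ‖x‖^p`. -/
def normPower (p : ℝ) (x : X) : ℝ := 1 / p * ‖x‖ ^ p

/-- The Bregman divergence `D_F^ξ(y, x) = F(y) - F(x) - ⟨ξ, y - x⟩`. -/
def bregman (F : X → ℝ) (ξ : X →L[ℝ] ℝ) (y x : X) : ℝ := F y - F x - ξ (y - x)

end BregmanBounds

end

namespace BregmanBounds

section

variable {X : Type*} [NormedAddCommGroup X] [NormedSpace ℝ X]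

/-! An element `ξ` of the duality mapping at `x` is a subgradient of `F = ‖·‖ ^ p / p`. Testing this
at the midpoint of `x` and `y` gives `D(y, x) ≥ F x + F y - 2 F((x + y) / 2)`. Testing it at the
reflection `2x - y` gives `D(y, x) ≤ F y + F(2x - y) - 2 F x`. Both bounds are second differences
free of `ξ`, and homogeneity reduces them to `max ‖x‖ ‖y‖ = 1`.

A second difference mixes a change of direction, which the moduli measure, with a scalar effect of
`t ↦ t ^ p`, which is quadratic. The scalar effect is absorbed because, in dimension at least two,
`ρ τ ≥ c τ²` on bounded intervals and `δ ε ≤ K ε²` (`exists_sq_le_modulusSmoothness`,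
`exists_modulusConvexity_le_sq`). These come from a plane whose norm is compared with a Euclidean
norm touching it at one point. The core estimates are `exists_modulusConvexity_le_of_norm_eq_one`
and `exists_le_modulusSmoothness_of_norm_le_one`.

Under a power law the bound becomes `M ^ (p - s) * ‖x - y‖ ^ s` with `M = max ‖x‖ ‖y‖`. The first
factor is `1` if `p = s`, and `M` is comparable to `‖x‖` if `‖x - y‖ / ‖x‖` is bounded. -/

/-! ### Planar sections and touching Euclidean norms -/

/-- A space of dimension at least two contains an injective linear image of the Euclidean plane. -/
theorem exists_injective_complex (hdim : 2 ≤ Module.rank ℝ X) :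
    ∃ L : ℂ →L[ℝ] X, ∀ z, L z = 0 → z = 0 := by
  obtain ⟨e, hli⟩ := (Module.le_rank_iff (n := 2)).1 (by exact_mod_cast hdim)
  obtain ⟨u, v, rfl⟩ : ∃ u v, e = ![u, v] :=
    ⟨e 0, e 1, by ext i; fin_cases i <;> rfl⟩
  rw [LinearIndependent.pair_iff] at hli
  refine ⟨Complex.reCLM.smulRight u + Complex.imCLM.smulRight v, fun z hz => ?_⟩
  obtain ⟨h1, h2⟩ := hli z.re z.im (by simpa using hz)
  exact Complex.ext h1 h2

theorem norm_add_ofReal_mul_I (a b : ℝ) (w : ℂ) (hw : ‖w‖ = 1) :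
    ‖w * (a + b * Complex.I)‖ ^ 2 = a ^ 2 + b ^ 2 := by
  rw [norm_mul, hw, one_mul, Complex.sq_norm, Complex.normSq_add_mul_I]

theorem map_mul_add_I (L : ℂ →L[ℝ] X) (w : ℂ) (a b : ℝ) :
    L (w * (a + b * Complex.I)) = a • L w + b • L (w * Complex.I) := by
  rw [← map_smul, ← map_smul, ← map_add]
  congr 1
  simp only [Complex.real_smul]
  ring

/-- A pair of unit vectors along which the norm grows at least quadratically. -/
theorem exists_norm_add_smul_ge (hdim : 2 ≤ Module.rank ℝ X) :
    ∃ x w : X, ∃ c : ℝ, 0 < c ∧ ‖x‖ = 1 ∧ ‖w‖ = 1 ∧ ∀ t : ℝ, 1 + c * t ^ 2 ≤ ‖x + t • w‖ ^ 2 := by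
  obtain ⟨L, hL⟩ := exists_injective_complex hdim
  -- At a minimiser `w` on the circle, the Euclidean norm scaled by `‖L w‖` lies below the norm and
  -- agrees with it at `w`. Pythagoras along the orthogonal direction `w * I` then gives the growth,
  -- and normalising both vectors gives `c`.
  obtain ⟨w, hw, hmin⟩ := (isCompact_sphere (0 : ℂ) 1).exists_isMinOn ⟨1, by simp⟩
    (L.continuous.norm.continuousOn)
  have hw1 : ‖w‖ = 1 := by simpa using hw
  have hw0 : w ≠ 0 := by rintro rfl; simp at hw1
  have hr : 0 < ‖L w‖ := norm_pos_iff.2 fun h => hw0 (hL _ h)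
  have hn : 0 < ‖L (w * Complex.I)‖ :=
    norm_pos_iff.2 fun h => mul_ne_zero hw0 Complex.I_ne_zero (hL _ h)
  have hbound : ∀ z, ‖L w‖ * ‖z‖ ≤ ‖L z‖ := by
    intro z
    rcases eq_or_ne z 0 with rfl | hz
    · simp
    have hz' := norm_pos_iff.2 hz
    have h := hmin (show (‖z‖⁻¹ : ℝ) • z ∈ Metric.sphere (0 : ℂ) 1 by
      simp [hz'.ne'])
    simp only [Set.mem_ofPred_eq, map_smul, norm_smul, norm_inv, norm_norm] at h
    rwa [inv_mul_eq_div, le_div_iff₀ hz'] at h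
  refine ⟨‖L w‖⁻¹ • L w, ‖L (w * Complex.I)‖⁻¹ • L (w * Complex.I),
    (‖L w‖ / ‖L (w * Complex.I)‖) ^ 2, by positivity, by simp [norm_smul, hr.ne'],
    by simp [norm_smul, hn.ne'], fun t => ?_⟩
  rw [smul_smul, ← map_mul_add_I]
  refine le_trans (le_of_eq ?_) (pow_le_pow_left₀ (by positivity) (hbound _) 2)
  rw [mul_pow, norm_add_ofReal_mul_I _ _ _ hw1]
  field_simp

/-- A pair of unit vectors along which the norm grows at most quadratically. -/
theorem exists_norm_add_smul_le (hdim : 2 ≤ Module.rank ℝ X) :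
    ∃ x w : X, ∃ C : ℝ, 0 < C ∧ ‖x‖ = 1 ∧ ‖w‖ = 1 ∧ ∀ t : ℝ, ‖x + t • w‖ ^ 2 ≤ 1 + C * t ^ 2 := by
  obtain ⟨L, hL⟩ := exists_injective_complex hdim
  -- At a maximiser the scaled Euclidean norm lies above the norm instead.
  obtain ⟨w, hw, hmax⟩ := (isCompact_sphere (0 : ℂ) 1).exists_isMaxOn ⟨1, by simp⟩
    (L.continuous.norm.continuousOn)
  have hw1 : ‖w‖ = 1 := by simpa using hw
  have hw0 : w ≠ 0 := by rintro rfl; simp at hw1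
  have hr : 0 < ‖L w‖ := norm_pos_iff.2 fun h => hw0 (hL _ h)
  have hn : 0 < ‖L (w * Complex.I)‖ :=
    norm_pos_iff.2 fun h => mul_ne_zero hw0 Complex.I_ne_zero (hL _ h)
  have hbound : ∀ z, ‖L z‖ ≤ ‖L w‖ * ‖z‖ := by
    intro z
    rcases eq_or_ne z 0 with rfl | hz
    · simp
    have hz' := norm_pos_iff.2 hz
    have h := hmax (show (‖z‖⁻¹ : ℝ) • z ∈ Metric.sphere (0 : ℂ) 1 by
      simp [hz'.ne'])
    simp only [Set.mem_ofPred_eq, map_smul, norm_smul, norm_inv, norm_norm] at h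
    rwa [inv_mul_eq_div, div_le_iff₀ hz'] at h
  refine ⟨‖L w‖⁻¹ • L w, ‖L (w * Complex.I)‖⁻¹ • L (w * Complex.I),
    (‖L w‖ / ‖L (w * Complex.I)‖) ^ 2, by positivity, by simp [norm_smul, hr.ne'],
    by simp [norm_smul, hn.ne'], fun t => ?_⟩
  rw [smul_smul, ← map_mul_add_I]
  refine (pow_le_pow_left₀ (by positivity) (hbound _) 2).trans (le_of_eq ?_)
  rw [mul_pow, norm_add_ofReal_mul_I _ _ _ hw1]
  field_simp

/-! ### The modulus of smoothness -/

theorem smoothness_le_of_unit {x y : X} (hx : ‖x‖ = 1) (hy : ‖y‖ = 1) (τ : ℝ) :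
    (‖x + τ • y‖ + ‖x - τ • y‖) / 2 - 1 ≤ modulusSmoothness X τ := by
  refine le_csSup ⟨|τ|, ?_⟩ ⟨x, y, hx, hy, rfl⟩
  rintro _ ⟨a, b, ha, hb, rfl⟩
  have h1 := norm_add_le a (τ • b)
  have h2 := norm_sub_le a (τ • b)
  rw [norm_smul, ha, hb, Real.norm_eq_abs] at h1 h2
  linarith

/-- An even convex function increases on the half-line: `x ± σy` are convex combinations of `x ± τy`
with exchanged weights. -/
theorem norm_add_add_norm_sub_mono (x y : X) {σ τ : ℝ} (hσ : 0 ≤ σ) (h : σ ≤ τ) :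
    ‖x + σ • y‖ + ‖x - σ • y‖ ≤ ‖x + τ • y‖ + ‖x - τ • y‖ := by
  rcases (hσ.trans h).eq_or_lt with rfl | hτ
  · rw [le_antisymm h hσ]
  set a := (1 + σ / τ) / 2
  set b := (1 - σ / τ) / 2
  have hb : 0 ≤ b := by
    have : σ / τ ≤ 1 := (div_le_one hτ).2 h
    simp only [b]; linarith
  have ha : 0 ≤ a := by positivity
  have hab : a + b = 1 := by simp only [a, b]; ring
  have hab' : (a - b) * τ = σ := by simp only [a, b]; field_simp; ring
  have e1 : x + σ • y = a • (x + τ • y) + b • (x - τ • y) := by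
    rw [← hab']
    have : x = (a + b) • x := by rw [hab, one_smul]
    nth_rw 1 [this]
    module
  have e2 : x - σ • y = b • (x + τ • y) + a • (x - τ • y) := by
    rw [← hab']
    have : x = (a + b) • x := by rw [hab, one_smul]
    nth_rw 1 [this]
    module
  have h1 := norm_add_le (a • (x + τ • y)) (b • (x - τ • y))
  have h2 := norm_add_le (b • (x + τ • y)) (a • (x - τ • y))
  rw [← e1, norm_smul_of_nonneg ha, norm_smul_of_nonneg hb] at h1
  rw [← e2, norm_smul_of_nonneg ha, norm_smul_of_nonneg hb] at h2
  have : b = 1 - a := by linarith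
  rw [this] at h1 h2
  linarith

/-- The modulus of smoothness is at least quadratic on bounded intervals. -/
theorem exists_sq_le_modulusSmoothness (hdim : 2 ≤ Module.rank ℝ X) :
    ∃ c : ℝ, 0 < c ∧ ∀ τ : ℝ, 0 ≤ τ → τ ≤ 4 → c * τ ^ 2 ≤ modulusSmoothness X τ := by
  obtain ⟨x, w, c, hc, hx, hw, h⟩ := exists_norm_add_smul_ge hdim
  -- This `k` satisfies `k (2 + 16 c) = c`, so `(1 + k τ²)² ≤ 1 + c τ²` whenever `τ² ≤ 16`; it
  -- removes the square root.
  refine ⟨c / (2 * (1 + 8 * c)), by positivity, fun τ h0 h4 => ?_⟩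
  refine le_trans ?_ (smoothness_le_of_unit hx hw τ)
  have key : ∀ a : ℝ, 0 ≤ a → 1 + c * τ ^ 2 ≤ a ^ 2 → c / (2 * (1 + 8 * c)) * τ ^ 2 ≤ a - 1 := by
    intro a ha0 ha
    set k := c / (2 * (1 + 8 * c)) with hk
    have hkc : k * (2 * (1 + 8 * c)) = c := by rw [hk]; field_simp
    have hk0 : 0 < k := by positivity
    have hτ : τ ^ 2 ≤ 16 := by nlinarith
    have : (1 + k * τ ^ 2) ^ 2 ≤ a ^ 2 := by
      have h1 : k ≤ c := by nlinarith
      have h2 : k * k * (τ ^ 2 * τ ^ 2) ≤ k * c * (τ ^ 2 * 16) := by gcongr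
      nlinarith
    have := abs_le_of_sq_le_sq' this ha0
    linarith [this.2]
  have h1 := key _ (norm_nonneg _) (h τ)
  have h2 := key ‖x - τ • w‖ (norm_nonneg _) (by
    have := h (-τ); rwa [neg_smul, ← sub_eq_add_neg, neg_sq] at this)
  linarith

/-! ### The modulus of convexity -/

theorem one_sub_half_norm_add_nonneg {E : Type*} [NormedAddCommGroup E] {y z : E} (hy : ‖y‖ = 1) (hz : ‖z‖ = 1) :
    0 ≤ 1 - ‖y + z‖ / 2 := by
  have := norm_add_le y z
  rw [hy, hz] at this
  linarith

theorem modulusConvexity_nonneg (E : Type*) [NormedAddCommGroup E] (ε : ℝ) :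
    0 ≤ modulusConvexity E ε := by
  refine Real.sInf_nonneg ?_
  rintro _ ⟨y, z, hy, hz, -, rfl⟩
  exact one_sub_half_norm_add_nonneg hy hz

theorem modulusConvexity_le_of_unit {E : Type*} [NormedAddCommGroup E] {y z : E} (hy : ‖y‖ = 1) (hz : ‖z‖ = 1) :
    modulusConvexity E ‖y - z‖ ≤ 1 - ‖y + z‖ / 2 := by
  refine csInf_le ⟨0, ?_⟩ ⟨y, z, hy, hz, rfl, rfl⟩
  rintro _ ⟨y, z, hy, hz, -, rfl⟩
  exact one_sub_half_norm_add_nonneg hy hz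

theorem modulusConvexity_le_one (E : Type*) [NormedAddCommGroup E] (ε : ℝ) :
    modulusConvexity E ε ≤ 1 := by
  rcases Set.eq_empty_or_nonempty
    {t : ℝ | ∃ y z : E, ‖y‖ = 1 ∧ ‖z‖ = 1 ∧ ‖y - z‖ = ε ∧ t = 1 - ‖y + z‖ / 2} with h | h
  -- With no pair at distance `ε` the infimum takes its default value `0`.
  · rw [modulusConvexity, h, Real.sInf_empty]; exact zero_le_one
  · obtain ⟨t, y, z, hy, hz, rfl, rfl⟩ := h
    have := modulusConvexity_le_of_unit hy hz
    have := norm_nonneg (y + z)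
    linarith

theorem norm_inv_smul_self {v : X} (hv : v ≠ 0) : ‖‖v‖⁻¹ • v‖ = 1 := by
  rw [norm_smul, norm_inv, norm_norm, inv_mul_cancel₀ (norm_ne_zero_iff.2 hv)]

/-- Quantitative monotonicity of the modulus of convexity. -/
theorem modulusConvexity_le_two_mul {x y : X} (hx : ‖x‖ = 1) (hy : ‖y‖ = 1) {ε : ℝ}
    (h0 : 0 ≤ ε) (hε : ε ≤ ‖x - y‖) : modulusConvexity X ε ≤ 2 * (1 - ‖x + y‖ / 2) := by
  set η := 1 - ‖x + y‖ / 2 with hη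
  rcases le_or_gt (1 / 2) η with hη2 | hη2
  · linarith [modulusConvexity_le_one X ε]
  -- With `f` norming `x + y`, both `f x` and `f y` are at least `1 - 2η > 0`, hence so is `f` on
  -- the whole segment. The segment avoids `0`, and its radial projection contains a point at
  -- distance exactly `ε` from `x`, where `f` still bounds the norm of the sum from below.
  obtain ⟨f, hf1, hf⟩ := exists_dual_vector'' ℝ (x + y)
  have hf' : ∀ v, f v ≤ ‖v‖ := fun v => (le_abs_self _).trans
    ((f.le_of_opNorm_le hf1 v).trans_eq (one_mul _))
  rw [map_add] at hf
  have hfx := hf' x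
  have hfy := hf' y
  have hfs : f x + f y = 2 * (1 - η) := by rw [hf, hη, RCLike.ofReal_real_eq_id, id]; ring
  rw [hx] at hfx
  rw [hy] at hfy
  let w : ℝ → X := fun t => (1 - t) • x + t • y
  have hfw : ∀ t ∈ Set.Icc (0 : ℝ) 1, 1 - 2 * η ≤ f (w t) := by
    rintro t ⟨ht0, ht1⟩
    simp only [w, map_add, map_smul, smul_eq_mul]
    nlinarith
  have hw0 : ∀ t ∈ Set.Icc (0 : ℝ) 1, w t ≠ 0 := by
    intro t ht h
    have := hfw t ht
    rw [h, map_zero] at this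
    linarith
  have hw1 : ∀ t ∈ Set.Icc (0 : ℝ) 1, ‖w t‖ ≤ 1 := by
    rintro t ⟨ht0, ht1⟩
    refine (norm_add_le _ _).trans ?_
    rw [norm_smul_of_nonneg (by linarith), norm_smul_of_nonneg ht0, hx, hy]
    linarith
  have hwc : Continuous w := by fun_prop
  have hcont : ContinuousOn (fun t => ‖x - ‖w t‖⁻¹ • w t‖) (Set.Icc 0 1) :=
    (continuousOn_const.sub ((hwc.norm.continuousOn.inv₀
      fun t ht => norm_ne_zero_iff.2 (hw0 t ht)).smul hwc.continuousOn)).norm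
  obtain ⟨t, ht, hte⟩ := intermediate_value_Icc (zero_le_one' ℝ) hcont
    (show ε ∈ Set.Icc _ _ by simpa [w, hx, hy] using ⟨h0, hε⟩)
  simp only at hte
  have hn := norm_pos_iff.2 (hw0 t ht)
  have hδ := modulusConvexity_le_of_unit hx (norm_inv_smul_self (hw0 t ht))
  rw [hte] at hδ
  have h1 := hf' (x + ‖w t‖⁻¹ • w t)
  rw [map_add, map_smul, smul_eq_mul] at h1
  have h2 : f (w t) ≤ ‖w t‖⁻¹ * f (w t) := by
    refine le_mul_of_one_le_left ?_ ((one_le_inv₀ hn).2 (hw1 t ht))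
    linarith [hfw t ht]
  linarith [hfw t ht]

/-- The modulus of convexity is at most quadratic. -/
theorem exists_modulusConvexity_le_sq (hdim : 2 ≤ Module.rank ℝ X) :
    ∃ K : ℝ, 0 < K ∧ ∀ ε : ℝ, 0 ≤ ε → modulusConvexity X ε ≤ K * ε ^ 2 := by
  obtain ⟨x, w, C, hC, hx, hw, h⟩ := exists_norm_add_smul_le hdim
  obtain ⟨f, hf1, hfx⟩ := exists_dual_vector'' ℝ x
  have hf : ∀ v, |f v| ≤ ‖v‖ := fun v => (f.le_of_opNorm_le hf1 v).trans_eq (one_mul _)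
  replace hfx : f x = 1 := by rw [hfx]; simp [hx]
  -- A nonzero `f w` would make `‖x + t • w‖` grow to first order in `t`, against the quadratic
  -- bound; `t = f w / (C + 1)` exhibits this.
  have hfw : f w = 0 := by
    by_contra hne
    set s := f w
    have h1 := h (s / (C + 1))
    have h2 := hf (x + (s / (C + 1)) • w)
    rw [map_add, map_smul, smul_eq_mul, hfx] at h2
    have h3 := pow_le_pow_left₀ (abs_nonneg _) h2 2
    rw [sq_abs] at h3
    have h4 := h3.trans h1
    set u := s / (C + 1) with hu
    have hs : s = u * (C + 1) := by rw [hu]; field_simp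
    change (1 + u * s) ^ 2 ≤ _ at h4
    have hu0 : 0 < u ^ 2 := by
      have : u ≠ 0 := by rintro h0; rw [h0, zero_mul] at hs; exact hne hs
      positivity
    rw [hs] at h4
    nlinarith [sq_nonneg (u * (u * (C + 1))), mul_pos hu0 hC]
  have hge : ∀ t : ℝ, 1 ≤ ‖x + t • w‖ := by
    intro t
    have := (le_abs_self _).trans (hf (x + t • w))
    simpa [hfx, hfw] using this
  have h' : ∀ t : ℝ, ‖x - t • w‖ ^ 2 ≤ 1 + C * t ^ 2 := fun t => by
    have := h (-t); rwa [neg_smul, ← sub_eq_add_neg, neg_sq] at this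
  have hge' : ∀ t : ℝ, 1 ≤ ‖x - t • w‖ := fun t => by
    have := hge (-t); rwa [neg_smul, ← sub_eq_add_neg] at this
  have hinv : ∀ a t : ℝ, 1 ≤ a → a ^ 2 ≤ 1 + C * t ^ 2 → 1 - C * t ^ 2 ≤ a⁻¹ := by
    intro a t ha hat
    have : a ≤ a ^ 2 := by nlinarith
    have h0 : 0 < a := by linarith
    rw [← one_div, le_div_iff₀ h0]
    nlinarith [mul_nonneg hC.le (sq_nonneg t)]
  have hinv1 : ∀ a t : ℝ, |t| ≤ 1 → 1 ≤ a → a ^ 2 ≤ 1 + C * t ^ 2 → (1 + C)⁻¹ ≤ a⁻¹ := by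
    intro a t ht ha hat
    have ht2 : t ^ 2 ≤ 1 := (sq_le_one_iff_abs_le_one t).2 ht
    exact inv_anti₀ (by linarith) (by nlinarith)
  let y : ℝ → X := fun t => ‖x + t • w‖⁻¹ • (x + t • w)
  let z : ℝ → X := fun t => ‖x - t • w‖⁻¹ • (x - t • w)
  have hne : ∀ t : ℝ, x + t • w ≠ 0 := fun t => norm_pos_iff.1 (by linarith [hge t])
  have hne' : ∀ t : ℝ, x - t • w ≠ 0 := fun t => norm_pos_iff.1 (by linarith [hge' t])
  have hy : ∀ t, ‖y t‖ = 1 := fun t => norm_inv_smul_self (hne t)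
  have hz : ∀ t, ‖z t‖ = 1 := fun t => norm_inv_smul_self (hne' t)
  have hδ : ∀ t, 1 - ‖y t + z t‖ / 2 ≤ C * t ^ 2 := by
    intro t
    have h1 := (le_abs_self _).trans (hf (y t + z t))
    simp only [y, z, map_add, map_smul, map_sub, hfx, hfw, smul_eq_mul, mul_zero, add_zero,
      sub_zero, mul_one] at h1
    have h2 := hinv _ t (hge t) (h t)
    have h3 := hinv _ t (hge' t) (h' t)
    simp only [y, z]
    linarith
  -- Here `f (y t - z t) = a - b`, so removing the `x`-component costs at most another `‖y t - z
  -- t‖`; the remaining `w`-component has size `t (a + b) ≥ 2t / (1 + C)`.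
  have hdist : ∀ t ∈ Set.Icc (0 : ℝ) 1, t * (1 + C)⁻¹ ≤ ‖y t - z t‖ := by
    rintro t ⟨ht0, ht1⟩
    set a := ‖x + t • w‖⁻¹ with ha
    set b := ‖x - t • w‖⁻¹ with hb
    have hta : |t| ≤ 1 := abs_le.2 ⟨by linarith, ht1⟩
    have h2 := hinv1 _ t hta (hge t) (h t)
    have h3 := hinv1 _ t hta (hge' t) (h' t)
    have e : y t - z t = (a - b) • x + (t * (a + b)) • w := by
      simp only [y, z, ← ha, ← hb]; module
    have h4 := hf (y t - z t)
    rw [e] at h4 ⊢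
    simp only [map_add, map_smul, hfx, hfw, smul_eq_mul, mul_zero, add_zero, mul_one] at h4
    have h5 := norm_sub_le ((a - b) • x + (t * (a + b)) • w) ((a - b) • x)
    rw [add_sub_cancel_left, norm_smul, norm_smul, hx, hw, Real.norm_eq_abs, Real.norm_eq_abs,
      mul_one, mul_one] at h5
    have h6 := le_abs_self (t * (a + b))
    nlinarith
  have hcont : ContinuousOn (fun t => ‖y t - z t‖) (Set.Icc 0 1) := by
    refine Continuous.continuousOn (Continuous.norm (Continuous.sub ?_ ?_))
    · exact (Continuous.inv₀ (by fun_prop) fun t => norm_ne_zero_iff.2 (hne t)).smul (by fun_prop)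
    · exact (Continuous.inv₀ (by fun_prop) fun t => norm_ne_zero_iff.2 (hne' t)).smul (by fun_prop)
  refine ⟨(1 + C) ^ 3, by positivity, fun ε hε => ?_⟩
  rcases le_or_gt ε ‖y 1 - z 1‖ with hε1 | hε1
  · obtain ⟨t, ht, hte⟩ := intermediate_value_Icc (zero_le_one' ℝ) hcont
      (show ε ∈ Set.Icc _ _ from ⟨by simpa [y, z] using hε, hε1⟩)
    simp only at hte
    have h1 := modulusConvexity_le_of_unit (hy t) (hz t)
    rw [hte] at h1
    have h2 := hdist t ht
    rw [hte, ← div_eq_mul_inv, div_le_iff₀ (by positivity)] at h2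
    have h3 := pow_le_pow_left₀ ht.1 h2 2
    have h4 := hδ t
    calc modulusConvexity X ε ≤ C * t ^ 2 := h1.trans h4
      _ ≤ (1 + C) * (ε * (1 + C)) ^ 2 := by gcongr; linarith
      _ = _ := by ring
  -- Beyond the distances reached by the curve, `ε (1 + C) ≥ 1`, and the trivial bound `δ ≤ 1`
  -- suffices.
  · have h2 := (hdist 1 (by simp)).trans hε1.le
    rw [one_mul, inv_le_iff_one_le_mul₀ (by positivity)] at h2
    have h3 := one_le_pow₀ h2 (n := 2)
    calc modulusConvexity X ε ≤ 1 := modulusConvexity_le_one X ε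
      _ ≤ (ε * (1 + C)) ^ 2 := h3
      _ ≤ (1 + C) * (ε * (1 + C)) ^ 2 := le_mul_of_one_le_left (by positivity) (by linarith)
      _ = _ := by ring

/-! ### One-dimensional estimates -/

/-- For `p ≤ 2` the second derivative of `t ^ p` on `(0, 1]` is at least `p (p - 1) = 2k`, so `t ^ p
- k t²` remains convex. Its midpoint inequality at `1` and `b` leaves `k (1 - b)² / 2`. -/
theorem exists_sq_le_rpow_midpoint_of_le_two {p : ℝ} (hp : 1 < p) (hp2 : p ≤ 2) :
    ∃ c : ℝ, 0 < c ∧ ∀ b : ℝ, 0 ≤ b → b ≤ 1 →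
      c * (1 - b) ^ 2 ≤ 1 + b ^ p - 2 * ((1 + b) / 2) ^ p := by
  set k := p * (p - 1) / 2 with hk
  have hk0 : 0 < k := by have : 0 < p - 1 := by linarith
                         positivity
  have hd : ∀ t : ℝ, 0 < t → HasDerivAt (fun t : ℝ => t ^ p - k * t ^ 2)
      (p * t ^ (p - 1) - k * (2 * t)) t := fun t ht => by
    have h1 := Real.hasDerivAt_rpow_const (x := t) (p := p) (Or.inl ht.ne')
    have h2 := ((hasDerivAt_pow 2 t).const_mul k)
    refine (h1.sub h2).congr_deriv ?_
    simp
  have hconv : ConvexOn ℝ (Set.Icc (0 : ℝ) 1) (fun t : ℝ => t ^ p - k * t ^ 2) := by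
    refine MonotoneOn.convexOn_of_deriv (convex_Icc 0 1) ?_ ?_ ?_
    · refine ContinuousOn.sub (fun t _ => ?_) (by fun_prop)
      exact (Real.continuousAt_rpow_const _ _ (Or.inr (by linarith))).continuousWithinAt
    · rw [interior_Icc]
      exact fun t ht => (hd t ht.1).differentiableAt.differentiableWithinAt
    · rw [interior_Icc]
      rintro s ⟨hs0, -⟩ t ⟨ht0, ht1⟩ hst
      rw [(hd s hs0).deriv, (hd t ht0).deriv]
      -- Bernoulli for the exponent `p - 1 ≤ 1` gives monotonicity of the derivative without second
      -- derivatives.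
      have h1 := rpow_one_add_le_one_add_mul_self (s := s / t - 1) (p := p - 1)
        (by have : 0 < s / t := by positivity
            linarith) (by linarith) (by linarith)
      rw [add_sub_cancel, Real.div_rpow hs0.le ht0.le, div_le_iff₀ (by positivity)] at h1
      have h2 : 1 ≤ t ^ (p - 1) / t := by
        rw [one_le_div ht0]
        conv_lhs => rw [← Real.rpow_one t]
        exact Real.rpow_le_rpow_of_exponent_ge ht0 ht1.le (by linarith)
      have h3 : (1 + (p - 1) * (s / t - 1)) * t ^ (p - 1)
          = t ^ (p - 1) - (p - 1) * (t - s) * (t ^ (p - 1) / t) := by field_simp; ring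
      rw [h3] at h1
      have h4 : (p - 1) * (t - s) * 1 ≤ (p - 1) * (t - s) * (t ^ (p - 1) / t) :=
        mul_le_mul_of_nonneg_left h2 (mul_nonneg (by linarith) (by linarith))
      rw [hk]
      nlinarith
  refine ⟨k / 2, by positivity, fun b h0 h1 => ?_⟩
  have := hconv.2 (show (1 : ℝ) ∈ Set.Icc (0 : ℝ) 1 by simp) (show b ∈ Set.Icc (0 : ℝ) 1 from ⟨h0, h1⟩)
    (show (0 : ℝ) ≤ 1 / 2 by norm_num) (show (0 : ℝ) ≤ 1 / 2 by norm_num) (by norm_num)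
  simp only [smul_eq_mul, Real.one_rpow] at this
  rw [show (1 / 2 * 1 + 1 / 2 * b : ℝ) = (1 + b) / 2 by ring] at this
  nlinarith

/-- Write `t ^ p = (t²) ^ (p / 2)` with `p / 2 ≥ 1`. Convexity reduces to `(1 + b²) / 2 = u² (1 +
s²)`, where `u` is the midpoint, and Bernoulli extracts the term in `s²`. -/
theorem exists_sq_le_rpow_midpoint_of_two_le {p : ℝ} (hp2 : 2 ≤ p) :
    ∃ c : ℝ, 0 < c ∧ ∀ b : ℝ, 0 ≤ b → b ≤ 1 →
      c * (1 - b) ^ 2 ≤ 1 + b ^ p - 2 * ((1 + b) / 2) ^ p := by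
  refine ⟨p * (1 / 2) ^ p / 4, by positivity, fun b h0 h1 => ?_⟩
  have hpow : ∀ a : ℝ, 0 ≤ a → (a ^ 2) ^ (p / 2) = a ^ p := fun a ha => by
    rw [← Real.rpow_natCast, ← Real.rpow_mul ha]; congr 1; push_cast; ring
  have hconv := (convexOn_rpow (show 1 ≤ p / 2 by linarith)).2
    (show (1 : ℝ) ∈ Set.Ici (0 : ℝ) by simp) (show b ^ 2 ∈ Set.Ici (0 : ℝ) from sq_nonneg b)
    (show (0 : ℝ) ≤ 1 / 2 by norm_num) (show (0 : ℝ) ≤ 1 / 2 by norm_num) (by norm_num)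
  simp only [smul_eq_mul, Real.one_rpow, hpow b h0] at hconv
  set u := (1 + b) / 2 with hu
  have hu0 : 1 / 2 ≤ u := by linarith
  have hu1 : u ≤ 1 := by linarith
  set s := (1 - b) / 2 / u with hs
  have e : (1 / 2 * 1 + 1 / 2 * b ^ 2 : ℝ) = u ^ 2 * (1 + s ^ 2) := by
    rw [hs]; field_simp; rw [hu]; ring
  rw [e, Real.mul_rpow (by positivity) (by positivity), hpow u (by linarith)] at hconv
  have hb := one_add_mul_self_le_rpow_one_add (s := s ^ 2) (p := p / 2)
    (by linarith [sq_nonneg s]) (by linarith)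
  have hup : (1 / 2 : ℝ) ^ p ≤ u ^ p := Real.rpow_le_rpow (by norm_num) hu0 (by linarith)
  have hss : ((1 - b) / 2) ^ 2 ≤ s ^ 2 := by
    refine pow_le_pow_left₀ (by linarith) ?_ 2
    rw [hs, le_div_iff₀ (by linarith)]
    nlinarith
  have h2 := mul_le_mul_of_nonneg_left hb (show 0 ≤ u ^ p by positivity)
  have h3 : (1 / 2 : ℝ) ^ p * ((1 - b) / 2) ^ 2 ≤ u ^ p * s ^ 2 := by gcongr
  have h4 := mul_le_mul_of_nonneg_left h3 (show 0 ≤ p by linarith)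
  nlinarith

theorem exists_sq_le_rpow_midpoint {p : ℝ} (hp : 1 < p) :
    ∃ c : ℝ, 0 < c ∧ ∀ b : ℝ, 0 ≤ b → b ≤ 1 →
      c * (1 - b) ^ 2 ≤ 1 + b ^ p - 2 * ((1 + b) / 2) ^ p :=
  (le_total p 2).elim (exists_sq_le_rpow_midpoint_of_le_two hp) exists_sq_le_rpow_midpoint_of_two_le

/-- The tangent line inequality for `t ↦ t ^ p`. -/
theorem rpow_sub_rpow_le {p u v : ℝ} (hp : 1 ≤ p) (hu : 0 < u) (hv : 0 ≤ v) :
    u ^ p - v ^ p ≤ p * u ^ (p - 1) * (u - v) := by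
  have h1 := one_add_mul_self_le_rpow_one_add (s := v / u - 1) (p := p)
    (by have : 0 ≤ v / u := by positivity
        linarith) hp
  rw [add_sub_cancel, Real.div_rpow hv hu.le, le_div_iff₀ (by positivity)] at h1
  rw [Real.rpow_sub_one hu.ne']
  have : (1 + p * (v / u - 1)) * u ^ p = u ^ p - p * (u ^ p / u) * (u - v) := by field_simp; ring
  linarith

/-- The tangent line at `t` gives `t ^ p - 1 ≤ p t ^ (p - 1) (t - 1)`, and `t ^ (p - 1)` is
Lipschitz on `[1/2, 3/2]`. -/
theorem exists_rpow_le_quadratic {p : ℝ} (hp : 1 < p) :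
    ∃ C : ℝ, 0 < C ∧ ∀ t : ℝ, |t - 1| ≤ 1 / 2 →
      t ^ p ≤ 1 + p * (t - 1) + C * (t - 1) ^ 2 := by
  have hd : ∀ t ∈ Set.Icc (1 / 2 : ℝ) (3 / 2),
      HasDerivAt (fun t : ℝ => t ^ (p - 1)) ((p - 1) * t ^ (p - 1 - 1)) t := fun t ht =>
    Real.hasDerivAt_rpow_const (Or.inl (by linarith [ht.1]))
  obtain ⟨L, hL⟩ := (isCompact_Icc (a := (1 / 2 : ℝ)) (b := 3 / 2)).exists_bound_of_continuousOn
    (f := fun t : ℝ => (p - 1) * t ^ (p - 1 - 1)) (continuousOn_const.mul fun t ht =>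
      (Real.continuousAt_rpow_const _ _ (Or.inl (by linarith [ht.1]))).continuousWithinAt)
  have hL0 : 0 ≤ L := (norm_nonneg _).trans (hL 1 (by norm_num))
  refine ⟨p * L + 1, by positivity, fun t ht => ?_⟩
  obtain ⟨ht1, ht2⟩ := abs_le.1 ht
  have h1 := Convex.norm_image_sub_le_of_norm_hasDerivWithin_le
    (fun t ht => (hd t ht).hasDerivWithinAt) hL (convex_Icc _ _)
    (show (1 : ℝ) ∈ Set.Icc (1 / 2 : ℝ) (3 / 2) by norm_num)
    (show t ∈ Set.Icc (1 / 2 : ℝ) (3 / 2) from ⟨by linarith, by linarith⟩)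
  simp only [Real.one_rpow, Real.norm_eq_abs] at h1
  have h2 := rpow_sub_rpow_le (u := t) (v := 1) hp.le (by linarith) zero_le_one
  rw [Real.one_rpow] at h2
  have h3 : (t ^ (p - 1) - 1) * (t - 1) ≤ L * (t - 1) ^ 2 := by
    calc (t ^ (p - 1) - 1) * (t - 1) ≤ |(t ^ (p - 1) - 1) * (t - 1)| := le_abs_self _
      _ = |t ^ (p - 1) - 1| * |t - 1| := abs_mul _ _
      _ ≤ L * |t - 1| * |t - 1| := by gcongr
      _ = L * (t - 1) ^ 2 := by rw [mul_assoc, ← sq, sq_abs]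
  have h4 := mul_le_mul_of_nonneg_left h3 (show 0 ≤ p by linarith)
  nlinarith [sq_nonneg (t - 1)]

/-! ### Estimates for second differences of the norm power -/

/-- If `1 - ‖y‖ ≥ ‖x - y‖ / 4`, strict convexity of `t ^ p` yields a multiple of `(1 - ‖y‖)²`, which
dominates the at most quadratic `δ`. Otherwise `z = y / ‖y‖` is still at distance at least `‖x - y‖
/ 3` from `x`, and `δ` forces a deficit in `‖x + z‖`, hence in `‖x + y‖`. -/
theorem exists_modulusConvexity_le_of_norm_eq_one (hdim : 2 ≤ Module.rank ℝ X) {p : ℝ}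
    (hp : 1 < p) :
    ∃ c : ℝ, 0 < c ∧ ∀ x y : X, ‖x‖ = 1 → ‖y‖ ≤ 1 →
      c * modulusConvexity X (‖x - y‖ / 3) ≤ ‖x‖ ^ p + ‖y‖ ^ p - 2 * (‖x + y‖ / 2) ^ p := by
  obtain ⟨K, hK, hδ⟩ := exists_modulusConvexity_le_sq hdim
  obtain ⟨k, hk, hrad⟩ := exists_sq_le_rpow_midpoint hp
  -- The factors are the lower bounds `b > 1/2` and `u ≥ 3/4` of the second case.
  set c₂ : ℝ := (1 / 2) * (3 / 4) ^ (p - 1) with hc₂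
  have hc₂0 : 0 < c₂ := by positivity
  refine ⟨min (k / (2 * K)) c₂, by positivity, fun x y hx hy => ?_⟩
  set d := ‖x - y‖
  set b := ‖y‖
  have hb0 : 0 ≤ b := norm_nonneg y
  have hδ0 := modulusConvexity_nonneg X (d / 3)
  have hm : ‖x + y‖ ≤ 1 + b := (norm_add_le x y).trans_eq (by rw [hx])
  have hd0 : 0 ≤ d := norm_nonneg _
  rw [hx, Real.one_rpow]
  rcases le_or_gt (d / 4) (1 - b) with h | h
  · have h1 : (‖x + y‖ / 2) ^ p ≤ ((1 + b) / 2) ^ p := by gcongr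
    have h2 := hrad b hb0 hy
    have h3 := hδ (d / 3) (by positivity)
    have h4 : (d / 3) ^ 2 ≤ 2 * (1 - b) ^ 2 := by nlinarith
    have h5 : min (k / (2 * K)) c₂ * modulusConvexity X (d / 3) ≤ k / (2 * K) * modulusConvexity X (d / 3) := by
      gcongr; exact min_le_left _ _
    have h6 : k / (2 * K) * modulusConvexity X (d / 3) ≤ k / (2 * K) * (K * (d / 3) ^ 2) := by gcongr
    have h7 : k / (2 * K) * (K * (d / 3) ^ 2) = k / 2 * (d / 3) ^ 2 := by field_simp
    have h8 : k / 2 * (d / 3) ^ 2 ≤ k / 2 * (2 * (1 - b) ^ 2) := by gcongr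
    linarith
  · have hd2 : d ≤ 1 + b := (norm_sub_le x y).trans_eq (by rw [hx])
    have hb : 1 / 2 < b := by linarith
    have hy0 : y ≠ 0 := norm_pos_iff.1 (by linarith : 0 < ‖y‖)
    set z := b⁻¹ • y with hz
    have hz1 : ‖z‖ = 1 := norm_inv_smul_self hy0
    have hyz : y = b • z := by rw [hz, smul_smul, mul_inv_cancel₀ (by linarith), one_smul]
    have hxz : d / 3 ≤ ‖x - z‖ := by
      have h1 : x - y = (x - z) + (1 - b) • z := by rw [hyz]; module
      have h2 := norm_add_le (x - z) ((1 - b) • z)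
      rw [← h1, norm_smul_of_nonneg (by linarith), hz1] at h2
      change d ≤ _ at h2
      linarith
    have h1 := modulusConvexity_le_two_mul hx hz1 (by positivity) hxz
    set η := 1 - ‖x + z‖ / 2 with hη
    have hη0 : 0 ≤ η := one_sub_half_norm_add_nonneg hx hz1
    have h2 : ‖x + y‖ / 2 ≤ (1 + b) / 2 - b * η := by
      have e : x + y = b • (x + z) + (1 - b) • x := by rw [hyz]; module
      have h2 := norm_add_le (b • (x + z)) ((1 - b) • x)
      rw [← e, norm_smul_of_nonneg hb0, norm_smul_of_nonneg (by linarith), hx] at h2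
      rw [hη]; linarith
    set u := (1 + b) / 2 with hu
    set v := ‖x + y‖ / 2 with hv
    have hv0 : 0 ≤ v := by positivity
    have hu1 : 3 / 4 ≤ u := by linarith
    have hvu : v ≤ u := by linarith
    have h3 : u ^ (p - 1) * (u - v) ≤ u ^ p - v ^ p := by
      have e1 : u ^ p = u ^ (p - 1) * u := by
        rw [← Real.rpow_add_one (by linarith)]; congr 1; ring
      have e2 : v ^ p ≤ u ^ (p - 1) * v := by
        rcases hv0.eq_or_lt with h0 | h0
        · rw [← h0, Real.zero_rpow (by linarith), mul_zero]
        · calc v ^ p = v ^ (p - 1) * v := by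
                rw [← Real.rpow_add_one h0.ne']; congr 1; ring
            _ ≤ u ^ (p - 1) * v := by gcongr
      linarith
    have h4 : (3 / 4 : ℝ) ^ (p - 1) * (b * η) ≤ u ^ (p - 1) * (u - v) := by
      gcongr
      linarith
    have h5 : 0 ≤ 1 + b ^ p - 2 * u ^ p := le_trans (by positivity) (hrad b hb0 hy)
    have h6 : min (k / (2 * K)) c₂ * modulusConvexity X (d / 3) ≤ c₂ * (2 * η) := by
      gcongr; exact min_le_right _ _
    have h7 : (3 / 4 : ℝ) ^ (p - 1) * (1 / 2 * η) ≤ (3 / 4 : ℝ) ^ (p - 1) * (b * η) := by gcongr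
    have h8 : c₂ * (2 * η) = 2 * ((3 / 4 : ℝ) ^ (p - 1) * (1 / 2 * η)) := by rw [hc₂]; ring
    linarith

/-- For `‖h‖ ≥ 1/4` the left side is bounded and `ρ` is bounded below. For small `h`, rescaling `x`
to a unit vector and expanding `t ^ p` at `1` leaves a linear term controlled by `ρ` and a quadratic
remainder absorbed by `ρ τ ≥ c τ²`. -/
theorem exists_le_modulusSmoothness_of_norm_le_one (hdim : 2 ≤ Module.rank ℝ X) {p : ℝ}
    (hp : 1 < p) :
    ∃ C : ℝ, 0 < C ∧ ∀ x h : X, max ‖x‖ ‖x + h‖ = 1 →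
      ‖x + h‖ ^ p + ‖x - h‖ ^ p - 2 * ‖x‖ ^ p ≤ C * modulusSmoothness X (2 * ‖h‖) := by
  obtain ⟨c, hc, hρ⟩ := exists_sq_le_modulusSmoothness hdim
  obtain ⟨K, hK, hU⟩ := exists_rpow_le_quadratic hp
  have hp0 : 0 < p := by linarith
  refine ⟨max ((1 + 3 ^ p) * 4 / c) (2 * p + 2 * K / c), by positivity, fun x h hmax => ?_⟩
  have hx : ‖x‖ ≤ 1 := hmax ▸ le_max_left _ _
  have hxh : ‖x + h‖ ≤ 1 := hmax ▸ le_max_right _ _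
  have hh : ‖h‖ ≤ 2 := by
    have := norm_sub_le (x + h) x
    rw [add_sub_cancel_left] at this
    linarith
  have hρh := hρ (2 * ‖h‖) (by positivity) (by linarith)
  have hρ0 : 0 ≤ modulusSmoothness X (2 * ‖h‖) := le_trans (by positivity) hρh
  rcases le_or_gt (1 / 4) ‖h‖ with h4 | h4
  · have h1 : ‖x + h‖ ^ p ≤ 1 := Real.rpow_le_one (norm_nonneg _) hxh hp0.le
    have h2 : ‖x - h‖ ^ p ≤ 3 ^ p :=
      Real.rpow_le_rpow (norm_nonneg _) (by linarith [norm_sub_le x h]) hp0.le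
    have h3 : 0 ≤ ‖x‖ ^ p := by positivity
    have h5 : c / 4 ≤ modulusSmoothness X (2 * ‖h‖) := by
      refine le_trans ?_ hρh
      rw [div_eq_mul_inv]
      gcongr
      nlinarith
    calc ‖x + h‖ ^ p + ‖x - h‖ ^ p - 2 * ‖x‖ ^ p ≤ 1 + 3 ^ p := by linarith
      _ = (1 + 3 ^ p) * 4 / c * (c / 4) := by field_simp
      _ ≤ _ := by gcongr; exact le_max_left _ _
  · rcases eq_or_ne h 0 with rfl | hne
    · rw [add_zero, sub_zero, ← two_mul, sub_self]; positivity
    have hh0 := norm_pos_iff.2 hne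
    set a := ‖x‖ with ha
    have ha34 : 3 / 4 ≤ a := by
      rcases max_choice a ‖x + h‖ with hm | hm
      · linarith
      · linarith [norm_add_le x h]
    have ha0 : 0 < a := by linarith
    set e := a⁻¹ • x with he
    set k := ‖h‖⁻¹ • h with hk
    have he1 : ‖e‖ = 1 := norm_inv_smul_self (norm_pos_iff.1 ha0)
    have hk1 : ‖k‖ = 1 := norm_inv_smul_self hne
    have hxe : x = a • e := by rw [he, smul_smul, mul_inv_cancel₀ ha0.ne', one_smul]
    set τ := ‖h‖ / a with hτ
    have hτ0 : 0 ≤ τ := by positivity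
    -- The factor `2` in the argument of `ρ` absorbs the division by `a ≥ 3/4`.
    have hτh : τ ≤ 2 * ‖h‖ := by rw [hτ, div_le_iff₀ ha0]; nlinarith
    have hhk : h = a • τ • k := by
      rw [hk, smul_smul, smul_smul, hτ, mul_div_cancel₀ _ ha0.ne', mul_inv_cancel₀ hh0.ne',
        one_smul]
    have e1 : ‖x + h‖ = a * ‖e + τ • k‖ := by
      rw [← norm_smul_of_nonneg ha0.le, smul_add, ← hxe, ← hhk]
    have e2 : ‖x - h‖ = a * ‖e - τ • k‖ := by
      rw [← norm_smul_of_nonneg ha0.le, smul_sub, ← hxe, ← hhk]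
    have hmono := norm_add_add_norm_sub_mono e k hτ0 hτh
    have hle := smoothness_le_of_unit he1 hk1 (2 * ‖h‖)
    have hτk : ‖τ • k‖ = τ := by rw [norm_smul_of_nonneg hτ0, hk1, mul_one]
    have b1 : |‖e + τ • k‖ - 1| ≤ τ := by
      have := abs_norm_sub_norm_le (e + τ • k) e
      rwa [he1, add_sub_cancel_left, hτk] at this
    have b2 : |‖e - τ • k‖ - 1| ≤ τ := by
      have := abs_norm_sub_norm_le (e - τ • k) e
      rwa [he1, sub_sub_cancel_left, norm_neg, hτk] at this
    have hτ2 : τ ≤ 1 / 2 := by linarith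
    have u1 := hU _ (b1.trans hτ2)
    have u2 := hU _ (b2.trans hτ2)
    set A := ‖e + τ • k‖
    set B := ‖e - τ • k‖
    set R := modulusSmoothness X (2 * ‖h‖)
    have q1 : (A - 1) ^ 2 ≤ (2 * ‖h‖) ^ 2 := by
      rw [← sq_abs]; exact pow_le_pow_left₀ (abs_nonneg _) (b1.trans hτh) 2
    have q2 : (B - 1) ^ 2 ≤ (2 * ‖h‖) ^ 2 := by
      rw [← sq_abs]; exact pow_le_pow_left₀ (abs_nonneg _) (b2.trans hτh) 2
    have q3 : (2 * ‖h‖) ^ 2 ≤ R / c := by rw [le_div_iff₀ hc]; linarith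
    have q4 : K * ((A - 1) ^ 2 + (B - 1) ^ 2) ≤ K * (2 * (R / c)) := by gcongr; linarith
    have q5 : p * (A + B - 2) ≤ p * (2 * R) := by gcongr; linarith
    have tot : A ^ p + B ^ p - 2 ≤ (2 * p + 2 * K / c) * R := by
      have : (2 * p + 2 * K / c) * R = p * (2 * R) + K * (2 * (R / c)) := by ring
      rw [this]; linarith
    have hap : a ^ p ≤ 1 := Real.rpow_le_one ha0.le hx hp0.le
    rw [e1, e2, Real.mul_rpow ha0.le (norm_nonneg _), Real.mul_rpow ha0.le (norm_nonneg _)]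
    calc a ^ p * A ^ p + a ^ p * B ^ p - 2 * a ^ p = a ^ p * (A ^ p + B ^ p - 2) := by ring
      _ ≤ a ^ p * ((2 * p + 2 * K / c) * R) := by gcongr
      _ ≤ (2 * p + 2 * K / c) * R := mul_le_of_le_one_left (by positivity) hap
      _ ≤ _ := by gcongr; exact le_max_right _ _

/-! ### The Bregman divergence -/

/-- The elements of the duality mapping are subgradients of the norm power. -/
theorem bregman_normPower_nonneg {p : ℝ} (hp : 1 < p) {x : X} {ξ : X →L[ℝ] ℝ}
    (hξ : ξ ∈ dualityMap p x) (y : X) : 0 ≤ bregman (normPower p) ξ y x := by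
  obtain ⟨h1, h2⟩ := hξ
  have hp0 : 0 < p := by linarith
  have h3 : ξ y ≤ ‖x‖ ^ (p - 1) * ‖y‖ := h2 ▸ (le_abs_self _).trans (ξ.le_opNorm y)
  rw [h2] at h1
  rw [bregman, normPower, normPower, map_sub, h1]
  -- The tangent line needs a positive base point; at `x = 0` the functional vanishes because `0 ^
  -- (p - 1) = 0`.
  rcases (norm_nonneg x).eq_or_lt with h0 | h0
  · rw [← h0, Real.zero_rpow (by linarith), zero_mul] at h3
    rw [← h0, mul_zero, Real.zero_rpow hp0.ne']
    have : 0 ≤ 1 / p * ‖y‖ ^ p := by positivity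
    linarith
  · have h4 := rpow_sub_rpow_le hp.le h0 (norm_nonneg y)
    have h5 : 1 / p * (‖x‖ ^ p - ‖y‖ ^ p) ≤ ‖x‖ ^ (p - 1) * (‖x‖ - ‖y‖) := by
      rw [one_div, inv_mul_le_iff₀ hp0]; linarith
    linarith

/-- The subgradient inequality at the midpoint bounds `ξ (y - x) / 2` from above. -/
theorem le_bregman_normPower {p : ℝ} (hp : 1 < p) {x : X} {ξ : X →L[ℝ] ℝ}
    (hξ : ξ ∈ dualityMap p x) (y : X) :
    1 / p * (‖x‖ ^ p + ‖y‖ ^ p - 2 * (‖x + y‖ / 2) ^ p) ≤ bregman (normPower p) ξ y x := by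
  have h := bregman_normPower_nonneg hp hξ ((1 / 2 : ℝ) • (x + y))
  have e : ‖(1 / 2 : ℝ) • (x + y)‖ = ‖x + y‖ / 2 := by
    rw [norm_smul_of_nonneg (by norm_num)]; ring
  simp only [bregman, normPower, e, map_sub, map_smul, map_add, smul_eq_mul] at h ⊢
  linarith

/-- The divergences at `y` and at its reflection `2x - y` add up to the second difference, and the
latter is nonnegative. -/
theorem bregman_normPower_le {p : ℝ} (hp : 1 < p) {x : X} {ξ : X →L[ℝ] ℝ}
    (hξ : ξ ∈ dualityMap p x) (y : X) :
    bregman (normPower p) ξ y x ≤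
      1 / p * (‖x + (y - x)‖ ^ p + ‖x - (y - x)‖ ^ p - 2 * ‖x‖ ^ p) := by
  have h := bregman_normPower_nonneg hp hξ (x - (y - x))
  rw [add_sub_cancel]
  simp only [bregman, normPower, map_sub] at h ⊢
  linarith

theorem exists_bregman_le_modulusSmoothness (hdim : 2 ≤ Module.rank ℝ X) {p : ℝ} (hp : 1 < p) :
    ∃ C : ℝ, 0 < C ∧ ∀ x y : X, ∀ ξ ∈ dualityMap p x,
      bregman (normPower p) ξ y x ≤
        C * max ‖x‖ ‖y‖ ^ p * modulusSmoothness X (2 * ‖x - y‖ / max ‖x‖ ‖y‖) := by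
  obtain ⟨C, hC, h⟩ := exists_le_modulusSmoothness_of_norm_le_one hdim hp
  have hp0 : 0 < p := by linarith
  refine ⟨1 / p * C, by positivity, fun x y ξ hξ => (bregman_normPower_le hp hξ y).trans ?_⟩
  rw [mul_assoc, mul_assoc]
  refine mul_le_mul_of_nonneg_left ?_ (by positivity)
  rcases (le_max_of_le_left (norm_nonneg x) : 0 ≤ max ‖x‖ ‖y‖).eq_or_lt with h0 | hM
  -- When `x = y = 0`, the factor `0 ^ p = 0` annihilates the right side whatever value `ρ` takes at
  -- `0 / 0`.
  · have hx : x = 0 := norm_le_zero_iff.1 (h0 ▸ le_max_left _ _)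
    have hy : y = 0 := norm_le_zero_iff.1 (h0 ▸ le_max_right _ _)
    simp [hx, hy, Real.zero_rpow hp0.ne']
  set M := max ‖x‖ ‖y‖ with hMdef
  have hs : ∀ v : X, ‖v‖ = M * ‖M⁻¹ • v‖ := fun v => by
    rw [norm_smul_of_nonneg (by positivity), mul_inv_cancel_left₀ hM.ne']
  have hs' : ∀ v : X, ‖v‖ ^ p = M ^ p * ‖M⁻¹ • v‖ ^ p := fun v => by
    conv_lhs => rw [hs v, Real.mul_rpow hM.le (norm_nonneg _)]
  have h1 := h (M⁻¹ • x) (M⁻¹ • (y - x)) (by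
    rw [← smul_add, add_sub_cancel, norm_smul_of_nonneg (by positivity),
      norm_smul_of_nonneg (by positivity), ← mul_max_of_nonneg _ _ (by positivity), ← hMdef,
      inv_mul_cancel₀ hM.ne'])
  rw [← smul_add, ← smul_sub] at h1
  have e : 2 * ‖x - y‖ / M = 2 * ‖M⁻¹ • (y - x)‖ := by
    rw [norm_smul_of_nonneg (by positivity), norm_sub_rev]; ring
  rw [hs' (x + _), hs' (x - _), hs' x, e]
  have := mul_le_mul_of_nonneg_left h1 (show 0 ≤ M ^ p by positivity)
  linarith

theorem exists_modulusConvexity_le_bregman (hdim : 2 ≤ Module.rank ℝ X) {p : ℝ} (hp : 1 < p) :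
    ∃ C : ℝ, 0 < C ∧ ∀ x y : X, ∀ ξ ∈ dualityMap p x,
      C * max ‖x‖ ‖y‖ ^ p * modulusConvexity X (‖x - y‖ / (3 * max ‖x‖ ‖y‖)) ≤
        bregman (normPower p) ξ y x := by
  obtain ⟨c, hc, h⟩ := exists_modulusConvexity_le_of_norm_eq_one hdim hp
  have hp0 : 0 < p := by linarith
  refine ⟨1 / p * c, by positivity, fun x y ξ hξ => le_trans ?_ (le_bregman_normPower hp hξ y)⟩
  rw [mul_assoc, mul_assoc]
  refine mul_le_mul_of_nonneg_left ?_ (by positivity)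
  rcases (le_max_of_le_left (norm_nonneg x) : 0 ≤ max ‖x‖ ‖y‖).eq_or_lt with h0 | hM
  · have hx : x = 0 := norm_le_zero_iff.1 (h0 ▸ le_max_left _ _)
    have hy : y = 0 := norm_le_zero_iff.1 (h0 ▸ le_max_right _ _)
    simp [hx, hy, Real.zero_rpow hp0.ne']
  set M := max ‖x‖ ‖y‖ with hMdef
  have hs : ∀ v : X, ‖v‖ = M * ‖M⁻¹ • v‖ := fun v => by
    rw [norm_smul_of_nonneg (by positivity), mul_inv_cancel_left₀ hM.ne']
  have hs' : ∀ v : X, ‖v‖ ^ p = M ^ p * ‖M⁻¹ • v‖ ^ p := fun v => by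
    conv_lhs => rw [hs v, Real.mul_rpow hM.le (norm_nonneg _)]
  have hle : ∀ v : X, ‖v‖ ≤ M → ‖M⁻¹ • v‖ ≤ 1 := fun v hv => by
    rw [norm_smul_of_nonneg (by positivity), inv_mul_le_iff₀ hM, mul_one]; exact hv
  have heq : ∀ v : X, M = ‖v‖ → ‖M⁻¹ • v‖ = 1 := fun v hv => by
    rw [norm_smul_of_nonneg (by positivity), ← hv, inv_mul_cancel₀ hM.ne']
  have h1 : c * modulusConvexity X (‖M⁻¹ • x - M⁻¹ • y‖ / 3) ≤ ‖M⁻¹ • x‖ ^ p + ‖M⁻¹ • y‖ ^ p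
      - 2 * (‖M⁻¹ • x + M⁻¹ • y‖ / 2) ^ p := by
    -- The midpoint second difference is symmetric in `x` and `y`, so the vector of larger norm may
    -- play the unit vector.
    rcases max_choice ‖x‖ ‖y‖ with hm | hm
    · exact h _ _ (heq x hm) (hle y (le_max_right _ _))
    · have := h _ _ (heq y hm) (hle x (le_max_left _ _))
      rwa [norm_sub_rev, add_comm (M⁻¹ • y), add_comm (‖M⁻¹ • y‖ ^ p)] at this
  rw [← smul_add, ← smul_sub] at h1
  have e : ‖x - y‖ / (3 * M) = ‖M⁻¹ • (x - y)‖ / 3 := by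
    rw [norm_smul_of_nonneg (by positivity)]; field_simp
  rw [Real.div_rpow (norm_nonneg _) zero_le_two] at h1 ⊢
  rw [hs' (x + _), hs' x, hs' y, e]
  have := mul_le_mul_of_nonneg_left h1 (show 0 ≤ M ^ p by positivity)
  refine le_trans (le_of_eq (by ring)) (this.trans (le_of_eq (by ring)))

/-! ### Spaces of power type -/

/-- Powers of comparable positive numbers are comparable. -/
theorem exists_rpow_le_mul_rpow (q : ℝ) {T : ℝ} (hT : 1 ≤ T) :
    ∃ C : ℝ, 0 < C ∧ ∀ a M : ℝ, 0 < a → a ≤ M → M ≤ T * a →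
      M ^ q ≤ C * a ^ q ∧ a ^ q ≤ C * M ^ q := by
  refine ⟨T ^ |q|, by positivity, fun a M ha haM hM => ?_⟩
  have hM0 : 0 < M := ha.trans_le haM
  have h1 : 1 ≤ T ^ |q| := Real.one_le_rpow hT (abs_nonneg q)
  rcases le_total 0 q with hq | hq
  · have h2 : a ^ q ≤ M ^ q := by gcongr
    have h3 : M ^ q ≤ (T * a) ^ q := by gcongr
    rw [Real.mul_rpow (by linarith) ha.le] at h3
    rw [abs_of_nonneg hq] at h1 ⊢
    exact ⟨h3, h2.trans (le_mul_of_one_le_left (by positivity) h1)⟩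
  · have h2 : M ^ q ≤ a ^ q := Real.rpow_le_rpow_of_nonpos ha haM hq
    have h3 : (T * a) ^ q ≤ M ^ q := Real.rpow_le_rpow_of_nonpos hM0 hM hq
    rw [Real.mul_rpow (by linarith) ha.le] at h3
    refine ⟨h2.trans (le_mul_of_one_le_left (by positivity) h1), ?_⟩
    rw [abs_of_nonpos hq, Real.rpow_neg (by linarith), ← div_eq_inv_mul, le_div_iff₀ (by positivity),
      mul_comm]
    exact h3

theorem max_norm_le_of_norm_sub_le {E : Type*} [NormedAddCommGroup E] {x y : E} (hx : x ≠ 0) {τ : ℝ} (hτ : 0 < τ)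
    (h : ‖x - y‖ / ‖x‖ ≤ τ) : max ‖x‖ ‖y‖ ≤ (1 + τ) * ‖x‖ := by
  have hx0 := norm_pos_iff.2 hx
  rw [div_le_iff₀ hx0] at h
  refine max_le (by nlinarith) ?_
  have := norm_sub_norm_le y x
  rw [norm_sub_rev] at this
  linarith

/-- In an `s`-smooth space the divergence is bounded by a power of the distance. -/
theorem exists_bregman_le_rpow (hdim : 2 ≤ Module.rank ℝ X) {p : ℝ} (hp : 1 < p) {s : ℝ}
    (hs : IsPowerSmooth X s) :
    ∃ C : ℝ, 0 < C ∧ ∀ x y : X, 0 < max ‖x‖ ‖y‖ → ∀ ξ ∈ dualityMap p x,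
      bregman (normPower p) ξ y x ≤ C * max ‖x‖ ‖y‖ ^ (p - s) * ‖x - y‖ ^ s := by
  obtain ⟨C, hC, h⟩ := exists_bregman_le_modulusSmoothness hdim hp
  obtain ⟨K, hK, hρ⟩ := hs
  refine ⟨C * K * 2 ^ s, by positivity, fun x y hM ξ hξ => ?_⟩
  -- The power law for `ρ` is assumed only for positive arguments.
  rcases eq_or_ne x y with rfl | hne
  · simp only [bregman, sub_self, map_zero]; positivity
  have hd : 0 < ‖x - y‖ := norm_pos_iff.2 (sub_ne_zero.2 hne)
  refine (h x y ξ hξ).trans ?_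
  refine (mul_le_mul_of_nonneg_left (hρ _ (by positivity)) (by positivity)).trans (le_of_eq ?_)
  rw [Real.div_rpow (by positivity) hM.le, Real.mul_rpow zero_le_two hd.le, Real.rpow_sub hM]
  ring

/-- In an `r`-convex space the divergence dominates a power of the distance. -/
theorem exists_rpow_le_bregman (hdim : 2 ≤ Module.rank ℝ X) {p : ℝ} (hp : 1 < p) {r : ℝ}
    (hr : IsPowerConvex X r) :
    ∃ C : ℝ, 0 < C ∧ ∀ x y : X, 0 < max ‖x‖ ‖y‖ → ∀ ξ ∈ dualityMap p x,
      C * max ‖x‖ ‖y‖ ^ (p - r) * ‖x - y‖ ^ r ≤ bregman (normPower p) ξ y x := by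
  obtain ⟨C, hC, h⟩ := exists_modulusConvexity_le_bregman hdim hp
  obtain ⟨K, hK, hδ⟩ := hr
  refine ⟨C * K / 3 ^ r, by positivity, fun x y hM ξ hξ => le_trans ?_ (h x y ξ hξ)⟩
  have hmem : ‖x - y‖ / (3 * max ‖x‖ ‖y‖) ∈ Set.Icc (0 : ℝ) 2 := by
    refine ⟨by positivity, ?_⟩
    rw [div_le_iff₀ (by positivity)]
    linarith [norm_sub_le x y, le_max_left ‖x‖ ‖y‖, le_max_right ‖x‖ ‖y‖]
  refine le_trans (le_of_eq ?_) (mul_le_mul_of_nonneg_left (hδ _ hmem) (by positivity))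
  rw [Real.div_rpow (norm_nonneg _) (by positivity), Real.mul_rpow (by norm_num) hM.le,
    Real.rpow_sub hM]
  field_simp

end

end BregmanBounds

/-! ### The main theorem -/

theorem mainTheorem2 {X : Type*} [NormedAddCommGroup X] [NormedSpace ℝ X] [CompleteSpace X]
    (hdim : 2 ≤ Module.rank ℝ X) (p : ℝ) (hp : 1 < p) :
    -- the global bounds, for every element of the duality mapping at `x`
    (∃ C₁ : ℝ, 0 < C₁ ∧ ∃ C₂ : ℝ, 0 < C₂ ∧
      ∀ x y : X, ∀ ξ ∈ BregmanBounds.dualityMap p x,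
        BregmanBounds.bregman (BregmanBounds.normPower p) ξ y x ≤
            C₁ * max ‖x‖ ‖y‖ ^ p *
              BregmanBounds.modulusSmoothness X (2 * ‖x - y‖ / max ‖x‖ ‖y‖) ∧
        C₂ * max ‖x‖ ‖y‖ ^ p *
              BregmanBounds.modulusConvexity X (‖x - y‖ / (3 * max ‖x‖ ‖y‖)) ≤
            BregmanBounds.bregman (BregmanBounds.normPower p) ξ y x) ∧
    -- the upper bounds in an `s`-smooth space
    (∀ s : ℝ, BregmanBounds.IsPowerSmooth X s →
      (p = s → ∃ C : ℝ, 0 < C ∧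
        ∀ x y : X, ∀ ξ ∈ BregmanBounds.dualityMap p x,
          BregmanBounds.bregman (BregmanBounds.normPower p) ξ y x ≤ C * ‖x - y‖ ^ s) ∧
      (p ≠ s → ∀ τ : ℝ, 0 < τ → ∃ C : ℝ, 0 < C ∧
        ∀ x y : X, x ≠ 0 → ‖x - y‖ / ‖x‖ ≤ τ → ∀ ξ ∈ BregmanBounds.dualityMap p x,
          BregmanBounds.bregman (BregmanBounds.normPower p) ξ y x ≤
            C * ‖x‖ ^ (p - s) * ‖x - y‖ ^ s)) ∧
    -- the lower bounds in an `r`-convex space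
    (∀ r : ℝ, BregmanBounds.IsPowerConvex X r →
      (p = r → ∃ C : ℝ, 0 < C ∧
        ∀ x y : X, ∀ ξ ∈ BregmanBounds.dualityMap p x,
          C * ‖x - y‖ ^ r ≤ BregmanBounds.bregman (BregmanBounds.normPower p) ξ y x) ∧
      (p ≠ r → ∀ τ : ℝ, 0 < τ → ∃ C : ℝ, 0 < C ∧
        ∀ x y : X, x ≠ 0 → ‖x - y‖ / ‖x‖ ≤ τ → ∀ ξ ∈ BregmanBounds.dualityMap p x,
          C * ‖x‖ ^ (p - r) * ‖x - y‖ ^ r ≤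
            BregmanBounds.bregman (BregmanBounds.normPower p) ξ y x)) := by
  obtain ⟨C₁, hC₁, h₁⟩ := BregmanBounds.exists_bregman_le_modulusSmoothness hdim hp
  obtain ⟨C₂, hC₂, h₂⟩ := BregmanBounds.exists_modulusConvexity_le_bregman hdim hp
  have hp0 : p ≠ 0 := by linarith
  have hzero : ∀ x y : X, 0 = max ‖x‖ ‖y‖ → x = 0 ∧ y = 0 := fun x y h =>
    ⟨norm_le_zero_iff.1 (h ▸ le_max_left _ _), norm_le_zero_iff.1 (h ▸ le_max_right _ _)⟩
  have hnonneg : ∀ x y : X, 0 ≤ max ‖x‖ ‖y‖ := fun x y => le_max_of_le_left (norm_nonneg x)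
  refine ⟨⟨C₁, hC₁, C₂, hC₂, fun x y ξ hξ => ⟨h₁ x y ξ hξ, h₂ x y ξ hξ⟩⟩,
    fun s hs => ?_, fun r hr => ?_⟩
  · obtain ⟨C, hC, h⟩ := BregmanBounds.exists_bregman_le_rpow hdim hp hs
    refine ⟨?_, fun _ τ hτ => ?_⟩
    · rintro rfl
      refine ⟨C, hC, fun x y ξ hξ => ?_⟩
      rcases (hnonneg x y).eq_or_lt with h0 | h0
      · obtain ⟨rfl, rfl⟩ := hzero x y h0
        simp [BregmanBounds.bregman, Real.zero_rpow hp0]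
      -- For `p = s` the factor `max ‖x‖ ‖y‖ ^ (p - s)` equals `1`.
      · simpa using h x y h0 ξ hξ
    -- Since `‖x‖ ≤ max ‖x‖ ‖y‖ ≤ (1 + τ) ‖x‖`, the powers of exponent `p - s` are comparable
    -- whatever the sign of the exponent.
    · obtain ⟨K, hK, hT⟩ :=
        BregmanBounds.exists_rpow_le_mul_rpow (p - s) (show 1 ≤ 1 + τ by linarith)
      refine ⟨C * K, by positivity, fun x y hx hxy ξ hξ => ?_⟩
      have hx0 := norm_pos_iff.2 hx
      refine (h x y (lt_max_of_lt_left hx0) ξ hξ).trans ?_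
      rw [mul_assoc C K]
      gcongr
      exact (hT _ _ hx0 (le_max_left _ _)
        (BregmanBounds.max_norm_le_of_norm_sub_le hx hτ hxy)).1
  · obtain ⟨C, hC, h⟩ := BregmanBounds.exists_rpow_le_bregman hdim hp hr
    refine ⟨?_, fun _ τ hτ => ?_⟩
    · rintro rfl
      refine ⟨C, hC, fun x y ξ hξ => ?_⟩
      rcases (hnonneg x y).eq_or_lt with h0 | h0
      · obtain ⟨rfl, rfl⟩ := hzero x y h0
        simp [BregmanBounds.bregman, Real.zero_rpow hp0]
      · simpa using h x y h0 ξ hξ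
    · obtain ⟨K, hK, hT⟩ :=
        BregmanBounds.exists_rpow_le_mul_rpow (p - r) (show 1 ≤ 1 + τ by linarith)
      refine ⟨C / K, by positivity, fun x y hx hxy ξ hξ => ?_⟩
      have hx0 := norm_pos_iff.2 hx
      refine le_trans ?_ (h x y (lt_max_of_lt_left hx0) ξ hξ)
      rw [div_mul_eq_mul_div, mul_div_assoc]
      gcongr
      rw [div_le_iff₀' hK]
      exact (hT _ _ hx0 (le_max_left _ _)
        (BregmanBounds.max_norm_le_of_norm_sub_le hx hτ hxy)).2
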